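/- Let $\mathcal H$ be a complex Hilbert space, let $\Theta$ be a nonempty compact metric space and $U$ a compact metric space. Let $\theta\mapsto\rho(\theta)$ be a map from $\Theta$ to the density operators on $\mathcal H$ (positive trace-class operators of trace one) which is (a) injective, and (b) regular: for every compact $K\subseteq\Theta$, $$\lim_{\delta\downarrow 0}\ \inf\bigl\{\|X\|_1 : X \text{ trace class},\ -X\le \rho(\theta)-\rho(\eta)\le X \text{ for all } \theta,\eta\in K \text{ with } d(\theta,\eta)<\delta\bigr\}=0 .$$ Let $w:\Theta\times U\to\mathbb R$ be a continuous loss function. A POVM is a map $M$ from the Borel sets of $U$ to the bounded positive operators on $\mathcal H$ that is countably additive in the weak operator topology and satisfies $M(U)=I$. The risk function of $M$ is $$R_M(\theta)=\int_U w(\theta,u)\,\mathrm{Tr}\,\rho(\theta)M(du),\qquad \theta\in\Theta .$$ Let $\mathcal P(\Theta)$ be the set of Borel probability measures on $\Theta$ (priors). A POVM $M$ is a *Bayes POVM with respect to* $\pi\in\mathcal P(\Theta)$ if it minimizes $\int_\Theta R_M\,d\pi$ over all POVMs, and a *minimax POVM* if it minimizes $\sup_{\theta\in\Theta}R_M(\theta)$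 over all POVMs. A prior $\pi_*\in\mathcal P(\Theta)$ is *least favorable* if $$\inf_M\int_\Theta R_M\,d\pi_*=\sup_{\pi\in\mathcal P(\Theta)}\ \inf_M\int_\Theta R_M\,d\pi ,$$ the infima being over all POVMs $M$. Then the following hold. 1. A least favorable prior exists, and for every least favorable prior $\pi_*$, every minimax POVM is a Bayes POVM with respect to $\pi_*$. 2. If $\pi_*$ is a least favorable prior and there is exactly one Bayes POVM with respect to $\pi_*$, then this POVM is minimax. -/

import Mathlib

open MeasureTheory Filter Topology
open scoped ENNReal InnerProductSpace

noncomputable section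

namespace QuantumDecision

section TraceClass

variable {H : Type*} [NormedAddCommGroup H] [InnerProductSpace ℂ H] [CompleteSpace H]

variable (H) in
/-- The set of vectors of the orthonormal basis `traceBasis H`. -/
def traceIndex : Set H := (exists_hilbertBasis ℂ H).choose

variable (H) in
/-- An orthonormal (Hilbert) basis of `H`, used to evaluate traces. The trace norm and the trace of
a trace-class operator do not depend on its choice. -/
def traceBasis : HilbertBasis (traceIndex H) ℂ H :=
  (exists_hilbertBasis ℂ H).choose_spec.choose

/-- The trace norm `‖T‖₁ = Tr |T|` (with `|T| = (T* T)^{1/2}`) of a bounded operator, in `[0, ∞]`. -/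
def traceNorm (T : H →L[ℂ] H) : ℝ≥0∞ :=
  ∑' i, ENNReal.ofReal (⟪traceBasis H i, CFC.abs T (traceBasis H i)⟫_ℂ).re

/-- `T` is of trace class, i.e. `Tr |T| < ∞`. -/
def IsTraceClass (T : H →L[ℂ] H) : Prop := traceNorm T < ∞

/-- The trace `Tr T = ∑ᵢ ⟨eᵢ, T eᵢ⟩` (used for trace-class operators only). -/
def trace (T : H →L[ℂ] H) : ℂ := ∑' i, ⟪traceBasis H i, T (traceBasis H i)⟫_ℂ

end TraceClass

section States

variable {H : Type*} [NormedAddCommGroup H] [InnerProductSpace ℂ H] [CompleteSpace H]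

variable (H) in
/-- Density operators: positive trace-class operators of trace one. The order on `H →L[ℂ] H` is the
usual order of operators (`A ≤ B` iff `B - A` is positive). -/
@[ext]
structure DensityOperator where
  op : H →L[ℂ] H
  nonneg : 0 ≤ op
  traceClass : IsTraceClass op
  trace_eq_one : trace op = 1

/-- `ω_T(K_δ)`: the infimum of `‖X‖₁` over the trace-class operators `X` with
`-X ≤ T θ - T η ≤ X` for all `θ, η ∈ K` with `d(θ, η) < δ`. It is `∞` if there is no such `X`. -/
def regularityModulus {Θ : Type*} [MetricSpace Θ] (T : Θ → H →L[ℂ] H) (K : Set Θ) (δ : ℝ) : ℝ≥0∞ :=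
  ⨅ X ∈ {X : H →L[ℂ] H | IsTraceClass X ∧
    ∀ θ ∈ K, ∀ η ∈ K, dist θ η < δ → -X ≤ T θ - T η ∧ T θ - T η ≤ X}, traceNorm X

/-- Regularity of an operator-valued function: `ω_T(K_δ) → 0` as `δ ↓ 0`, for each compact `K`. -/
def IsRegularFamily {Θ : Type*} [MetricSpace Θ] (T : Θ → H →L[ℂ] H) : Prop :=
  ∀ K : Set Θ, IsCompact K → Tendsto (regularityModulus T K) (𝓝[>] 0) (𝓝 0)

end States

section POVMs

/-- A positive-operator-valued measure on the Borel sets of `U`. Sets that are not measurable are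
sent to `0`, so that two POVMs are equal iff they agree on all Borel sets. -/
@[ext]
structure POVM (U : Type*) [MeasurableSpace U] (H : Type*) [NormedAddCommGroup H]
    [InnerProductSpace ℂ H] [CompleteSpace H] where
  effect : Set U → H →L[ℂ] H
  not_measurable : ∀ B, ¬ MeasurableSet B → effect B = 0
  nonneg : ∀ B, MeasurableSet B → 0 ≤ effect B
  /-- Countable additivity, in the weak operator topology. -/
  hasSum_iUnion : ∀ B : ℕ → Set U, (∀ j, MeasurableSet (B j)) →
    Pairwise (fun i j => Disjoint (B i) (B j)) →
    ∀ x y : H, HasSum (fun j => ⟪x, effect (B j) y⟫_ℂ) ⟪x, effect (⋃ j, B j) y⟫_ℂ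
  effect_univ : effect Set.univ = 1

variable {H : Type*} [NormedAddCommGroup H] [InnerProductSpace ℂ H] [CompleteSpace H]
variable {U : Type*} [MeasurableSpace U]

theorem DensityOperator.inner_op (ρ : DensityOperator H) (x y : H) :
    ⟪x, ρ.op y⟫_ℂ = ⟪CFC.sqrt ρ.op x, CFC.sqrt ρ.op y⟫_ℂ := by
  have hs : (CFC.sqrt ρ.op).IsPositive :=
    (ContinuousLinearMap.nonneg_iff_isPositive _).1 (CFC.sqrt_nonneg _)
  rw [hs.inner_left_eq_inner_right]
  conv_lhs => rw [← CFC.sqrt_mul_sqrt_self ρ.op ρ.nonneg]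
  rfl

theorem DensityOperator.summable_sq (ρ : DensityOperator H) :
    Summable fun i => ‖CFC.sqrt ρ.op (traceBasis H i)‖ ^ 2 := by
  have h := ρ.traceClass
  unfold IsTraceClass traceNorm at h
  rw [CFC.abs_of_nonneg ρ.op ρ.nonneg] at h
  have h2 : ∀ i, (⟪traceBasis H i, ρ.op (traceBasis H i)⟫_ℂ).re
      = ‖CFC.sqrt ρ.op (traceBasis H i)‖ ^ 2 := by
    intro i
    rw [ρ.inner_op, inner_self_eq_norm_sq_to_K]
    norm_cast
  simp_rw [h2] at h
  have h3 := ENNReal.summable_toReal h.ne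
  refine h3.congr fun i => ?_
  rw [ENNReal.toReal_ofReal (by positivity)]

theorem hasSum_normSq (x : H) :
    HasSum (fun i => ‖⟪traceBasis H i, x⟫_ℂ‖ ^ 2) (‖x‖ ^ 2) := by
  have h := (traceBasis H).hasSum_inner_mul_inner x x
  rw [inner_self_eq_norm_sq_to_K] at h
  have h2 := Complex.hasSum_re h
  convert h2 using 1
  · funext i
    rw [← inner_conj_symm x, ← Complex.normSq_eq_conj_mul_self, Complex.ofReal_re,
      Complex.normSq_eq_norm_sq]
  · norm_cast

/-- `Tr (ρ A) = ∑ⱼ ⟨√ρ eⱼ, A √ρ eⱼ⟩`. -/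
theorem DensityOperator.trace_mul (ρ : DensityOperator H) (A : H →L[ℂ] H) :
    trace (ρ.op * A) = ∑' j, ⟪CFC.sqrt ρ.op (traceBasis H j),
      A (CFC.sqrt ρ.op (traceBasis H j))⟫_ℂ := by
  set S := CFC.sqrt ρ.op with hS
  set e := traceBasis H with he
  have hs : S.IsPositive :=
    (ContinuousLinearMap.nonneg_iff_isPositive _).1 (CFC.sqrt_nonneg _)
  let A' : H →L[ℂ] H := ContinuousLinearMap.adjoint A
  let F : traceIndex H → traceIndex H → ℂ := fun j i =>
    ⟪e i, S (e j)⟫_ℂ * ⟪A' (S (e j)), e i⟫_ℂ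
  have hg : ∀ B : H →L[ℂ] H, Summable fun p : traceIndex H × traceIndex H =>
      ‖⟪e p.2, B (S (e p.1))⟫_ℂ‖ ^ 2 := by
    intro B
    refine (summable_prod_of_nonneg (fun p => by positivity)).2 ⟨fun j => ?_, ?_⟩
    · exact (hasSum_normSq (B (S (e j)))).summable
    · have : ∀ j, ∑' i, ‖⟪e i, B (S (e j))⟫_ℂ‖ ^ 2 = ‖B (S (e j))‖ ^ 2 :=
        fun j => (hasSum_normSq (B (S (e j)))).tsum_eq
      simp only [this]
      refine Summable.of_nonneg_of_le (fun _ => by positivity) (fun j => ?_)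
        (ρ.summable_sq.mul_left (‖B‖ ^ 2))
      rw [← mul_pow]
      exact pow_le_pow_left₀ (norm_nonneg _) (B.le_opNorm _) 2
  have hF : Summable (Function.uncurry F) := by
    refine Summable.of_norm_bounded ((hg 1).add (hg A')) fun p => ?_
    simp only [Function.uncurry, F, norm_mul]
    rw [norm_inner_symm (A' (S (e p.1)))]
    change ‖⟪e p.2, S (e p.1)⟫_ℂ‖ * _ ≤ ‖⟪e p.2, S (e p.1)⟫_ℂ‖ ^ 2 + _
    nlinarith [sq_nonneg (‖⟪e p.2, S (e p.1)⟫_ℂ‖ - ‖⟪e p.2, A' (S (e p.1))⟫_ℂ‖),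
      norm_nonneg ⟪e p.2, S (e p.1)⟫_ℂ, norm_nonneg ⟪e p.2, A' (S (e p.1))⟫_ℂ]
  have h1 : ∀ i, ⟪e i, (ρ.op * A) (e i)⟫_ℂ = ∑' j, F j i := by
    intro i
    change ⟪e i, ρ.op (A (e i))⟫_ℂ = _
    rw [ρ.inner_op, ← hS, ← e.tsum_inner_mul_inner]
    refine tsum_congr fun j => ?_
    simp only [F, A', ContinuousLinearMap.adjoint_inner_left]
    rw [hs.inner_left_eq_inner_right, hs.inner_left_eq_inner_right]
  have h2 : ∀ j, ⟪S (e j), A (S (e j))⟫_ℂ = ∑' i, F j i := by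
    intro j
    rw [← ContinuousLinearMap.adjoint_inner_left, ← e.tsum_inner_mul_inner]
    exact tsum_congr fun i => mul_comm _ _
  unfold trace
  rw [← he]
  simp only [h1, h2]
  exact hF.tsum_comm

theorem DensityOperator.summable_inner (ρ : DensityOperator H) (A : H →L[ℂ] H) :
    Summable fun j => ⟪CFC.sqrt ρ.op (traceBasis H j), A (CFC.sqrt ρ.op (traceBasis H j))⟫_ℂ := by
  refine Summable.of_norm_bounded (ρ.summable_sq.mul_left ‖A‖) fun j => ?_
  refine (norm_inner_le_norm _ _).trans ?_
  have := A.le_opNorm (CFC.sqrt ρ.op (traceBasis H j))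
  nlinarith [norm_nonneg (CFC.sqrt ρ.op (traceBasis H j))]

/-- For `A ≥ 0`, `Tr (ρ A)` is a sum of non-negative terms. -/
theorem DensityOperator.ofReal_trace_mul (ρ : DensityOperator H) {A : H →L[ℂ] H} (hA : 0 ≤ A) :
    ENNReal.ofReal (trace (ρ.op * A)).re =
      ∑' j, ENNReal.ofReal (⟪CFC.sqrt ρ.op (traceBasis H j),
        A (CFC.sqrt ρ.op (traceBasis H j))⟫_ℂ).re := by
  have hp := (ContinuousLinearMap.nonneg_iff_isPositive _).1 hA
  have h := Complex.hasSum_re (ρ.summable_inner A).hasSum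
  rw [ρ.trace_mul, ← h.tsum_eq]
  exact ENNReal.ofReal_tsum_of_nonneg (fun j => hp.re_inner_nonneg_right _) h.summable

theorem POVM.ofReal_inner_iUnion (M : POVM U H) {B : ℕ → Set U} (hB : ∀ j, MeasurableSet (B j))
    (hd : Pairwise (fun i j => Disjoint (B i) (B j))) (x : H) :
    ENNReal.ofReal (⟪x, M.effect (⋃ j, B j) x⟫_ℂ).re =
      ∑' j, ENNReal.ofReal (⟪x, M.effect (B j) x⟫_ℂ).re := by
  have h := Complex.hasSum_re (M.hasSum_iUnion B hB hd x x)
  rw [← h.tsum_eq]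
  exact ENNReal.ofReal_tsum_of_nonneg (fun j => ((ContinuousLinearMap.nonneg_iff_isPositive _).1
    (M.nonneg _ (hB j))).re_inner_nonneg_right _) h.summable

theorem POVM.effect_empty (M : POVM U H) : M.effect ∅ = 0 := by
  ext y
  refine ext_inner_left ℂ fun x => ?_
  have h := M.hasSum_iUnion (fun _ => ∅) (fun _ => MeasurableSet.empty)
    (fun _ _ _ => by simp) x y
  have h0 := (summable_const_iff _).1 h.summable
  simpa using h0

/-- The distribution `B ↦ Tr ρ M(B)` of the outcome of the measurement `M` in the state `ρ`
(Born rule). -/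
def POVM.outcome (M : POVM U H) (ρ : DensityOperator H) : Measure U :=
  Measure.ofMeasurable (fun B _ => ENNReal.ofReal (trace (ρ.op * M.effect B)).re)
    (by simp [M.effect_empty, trace])
    (by
      intro B hB hd
      simp only [ρ.ofReal_trace_mul (M.nonneg _ (MeasurableSet.iUnion hB)),
        fun j => ρ.ofReal_trace_mul (M.nonneg _ (hB j)), M.ofReal_inner_iUnion hB hd]
      exact ENNReal.tsum_comm)

/-- The Born rule: the outcome distribution gives the Borel set `B` the mass `Tr ρ M(B)`. -/
theorem POVM.outcome_apply (M : POVM U H) (ρ : DensityOperator H) {B : Set U}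
    (hB : MeasurableSet B) :
    M.outcome ρ B = ENNReal.ofReal (trace (ρ.op * M.effect B)).re :=
  Measure.ofMeasurable_apply B hB

end POVMs

section Decision

variable {H : Type*} [NormedAddCommGroup H] [InnerProductSpace ℂ H] [CompleteSpace H]
variable {Θ : Type*} [MeasurableSpace Θ] {U : Type*} [MeasurableSpace U]

/-- The risk function `R_M(θ) = ∫ w(θ, u) Tr ρ(θ) M(du)`. -/
def risk (ρ : Θ → DensityOperator H) (w : Θ → U → ℝ) (M : POVM U H) (θ : Θ) : ℝ :=
  ∫ u, w θ u ∂(M.outcome (ρ θ))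

/-- The average risk `∫ R_M(θ) π(dθ)` under the prior `π`. -/
def averageRisk (ρ : Θ → DensityOperator H) (w : Θ → U → ℝ) (M : POVM U H)
    (π : ProbabilityMeasure Θ) : ℝ :=
  ∫ θ, risk ρ w M θ ∂(π : Measure Θ)

/-- `M` is a Bayes POVM with respect to the prior `π`: it minimizes the average risk. -/
def IsBayesPOVM (ρ : Θ → DensityOperator H) (w : Θ → U → ℝ) (π : ProbabilityMeasure Θ)
    (M : POVM U H) : Prop :=
  ∀ M' : POVM U H, averageRisk ρ w M π ≤ averageRisk ρ w M' π

/-- `M` is a minimax POVM: it minimizes the worst-case risk. Suprema and infima of risks are taken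
in the extended real line. -/
def IsMinimaxPOVM (ρ : Θ → DensityOperator H) (w : Θ → U → ℝ) (M : POVM U H) : Prop :=
  ∀ M' : POVM U H, ⨆ θ, (risk ρ w M θ : EReal) ≤ ⨆ θ, (risk ρ w M' θ : EReal)

/-- `π` is a least favorable prior: it maximizes the minimal average risk, that is,
`inf_M ∫ R_M dπ = sup_π' inf_M ∫ R_M dπ'`. -/
def IsLeastFavorablePrior (ρ : Θ → DensityOperator H) (w : Θ → U → ℝ)
    (π : ProbabilityMeasure Θ) : Prop :=
  ⨅ M : POVM U H, (averageRisk ρ w M π : EReal) =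
    ⨆ π' : ProbabilityMeasure Θ, ⨅ M : POVM U H, (averageRisk ρ w M π' : EReal)

end Decision

end QuantumDecision

end

/-! The proof is minimax duality. Let `V` be the infimum over POVMs of the worst-case risk.
Measurements can be randomized, so the risk functions form a convex set, and regularity of the
states makes them continuous (`continuous_risk`). POVMs are weakly compact, so as soon as one exists
some POVM attains `V` (`exists_isMinimaxPOVM`). Then every risk function reaches the level `V`
somewhere. Hahn–Banach separates the risk functions from the open convex set of functions below `V`,
and Riesz turns the separating functional into a prior `π₀` under which every average risk is at
least `V` (`exists_prior_iInf_averageRisk_eq`).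

An average never exceeds a supremum, so no prior has Bayes risk above `V`: `π₀` is least favorable,
and every least favorable prior has Bayes risk `V`. A minimax POVM has average risk at most `V`
under any prior, hence is Bayes for each least favorable one. If the Bayes POVM is unique, it must
be the minimax POVM that exists by compactness.

Convexity and compactness are checked on the scalar measures `⟨x, M(·) x⟩`. Such a family comes from
a POVM when its total masses are `‖x‖²` and the masses of each Borel set form a Hermitian quadratic
form in `x` (`POVM.exists_of_vectorMeasure`). These forms are a pointwise closed subspace, so the
condition survives mixtures and limits. -/

noncomputable section

namespace QuantumDecision

/-! ### Riesz representation and separation on a compact space -/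

section FunctionalAnalysis

variable {X : Type*} [TopologicalSpace X] [CompactSpace X] [T2Space X] [MeasurableSpace X]
  [BorelSpace X]

/-- Riesz–Markov–Kakutani on a compact space: a positive linear functional on the continuous
functions is integration against a finite measure. -/
theorem exists_measure_of_positive (Λ : C(X, ℝ) →ₗ[ℝ] ℝ) (hΛ : ∀ f, 0 ≤ f → 0 ≤ Λ f) :
    ∃ μ : Measure X, IsFiniteMeasure μ ∧ ∀ f : C(X, ℝ), ∫ x, f x ∂μ = Λ f := by
  let L : CompactlySupportedContinuousMap X ℝ →ₗ[ℝ] ℝ :=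
    { toFun := fun f => Λ f.toContinuousMap
      map_add' := fun f g => Λ.map_add _ _
      map_smul' := fun c f => Λ.map_smul _ _ }
  let P : CompactlySupportedContinuousMap X ℝ →ₚ[ℝ] ℝ :=
    { L with
      monotone' := fun f g hfg => by
        have h := hΛ (g.toContinuousMap - f.toContinuousMap) fun x => sub_nonneg.2 (hfg x)
        rw [map_sub] at h
        exact sub_nonneg.1 h }
  refine ⟨RealRMK.rieszMeasure P, inferInstance, fun f => ?_⟩
  exact RealRMK.integral_rieszMeasure P (CompactlySupportedContinuousMap.continuousMapEquiv f)

/-- Minimax duality: a convex set of continuous functions on a compact space all of which reach the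
level `V` admits a probability measure with respect to which all means are at least `V`. -/
theorem exists_probabilityMeasure_le_integral [Nonempty X] {R : Set C(X, ℝ)} (hR : Convex ℝ R)
    {V : ℝ} (hV : ∀ r ∈ R, ∃ x, V ≤ r x) :
    ∃ π : ProbabilityMeasure X, ∀ r ∈ R, V ≤ ∫ x, r x ∂(π : Measure X) := by
  rcases R.eq_empty_or_nonempty with rfl | ⟨r₀, hr₀⟩
  · exact ⟨⟨Measure.dirac (Classical.arbitrary X), inferInstance⟩, by simp⟩
  let A : Set C(X, ℝ) := {f | ∀ x, f x < V}
  have hAo : IsOpen A := by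
    have : A = {f : C(X, ℝ) | Set.MapsTo f Set.univ (Set.Iio V)} := by
      ext f; simp [A, Set.MapsTo]
    rw [this]
    exact ContinuousMap.isOpen_setOfPred_mapsTo isCompact_univ isOpen_Iio
  have hAc : Convex ℝ A := by
    intro f hf g hg a b ha hb hab x
    exact (convex_Iio V) (hf x) (hg x) ha hb hab
  have hdisj : Disjoint A R := by
    rw [Set.disjoint_left]
    intro f hf hfR
    obtain ⟨x, hx⟩ := hV f hfR
    exact absurd (hf x) (not_lt.2 hx)
  obtain ⟨Λ, s, hA, hB⟩ := geometric_hahn_banach_open hAc hAo hR hdisj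
  have hconst : ∀ c < V, ContinuousMap.const X c ∈ A := fun c hc x => hc
  -- `A` is stable under subtracting `t • g` with `g ≥ 0`, so a negative `Λ g` would make `Λ`
  -- unbounded above on `A`. The value of `t` below makes `Λ f - t * Λ g` exactly `s`.
  have hpos : ∀ g : C(X, ℝ), 0 ≤ g → 0 ≤ Λ g := by
    intro g hg
    by_contra! hneg
    set f := ContinuousMap.const X (V - 1)
    have hf : ∀ t : ℝ, 0 ≤ t → Λ f - t * Λ g < s := by
      intro t ht
      have : f - t • g ∈ A := fun x => by
        have : 0 ≤ t * g x := mul_nonneg ht (hg x)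
        simp only [f, ContinuousMap.sub_apply, ContinuousMap.const_apply,
          ContinuousMap.smul_apply, smul_eq_mul]
        linarith
      simpa using hA _ this
    have h0 := hf 0 le_rfl
    have := hf ((s - Λ f) / (-Λ g)) (div_nonneg (by linarith) (by linarith))
    have h2 : (s - Λ f) / (-Λ g) * Λ g = -(s - Λ f) := by
      rw [div_neg, neg_mul, div_mul_cancel₀ _ hneg.ne]
    linarith
  obtain ⟨μ, hμ, hint⟩ := exists_measure_of_positive (Λ : C(X, ℝ) →ₗ[ℝ] ℝ) hpos
  have hΛ : ∀ f : C(X, ℝ), Λ f = ∫ x, f x ∂μ := fun f => (hint f).symm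
  -- A zero functional cannot separate strictly: it would give `0 < s ≤ 0`.
  have hμ0 : μ ≠ 0 := by
    rintro rfl
    have h1 := hA _ (hconst (V - 1) (by linarith))
    have h2 := hB _ hr₀
    rw [hΛ] at h1 h2
    simp only [integral_zero_measure] at h1 h2
    linarith
  have hm : 0 < μ.real Set.univ := by
    rw [measureReal_def]
    exact ENNReal.toReal_pos (by simpa using hμ0) (measure_ne_top _ _)
  -- Constants just below `V` lie in `A`; the gap is scaled by the total mass so that the error is
  -- `ε`.
  have hVs : V * μ.real Set.univ ≤ s := by
    refine le_of_forall_pos_le_add fun ε hε => ?_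
    have := hA _ (hconst (V - ε / μ.real Set.univ) (by have := div_pos hε hm; linarith))
    rw [hΛ] at this
    simp only [ContinuousMap.const_apply, integral_const, smul_eq_mul] at this
    have h2 : μ.real Set.univ * (V - ε / μ.real Set.univ) = V * μ.real Set.univ - ε := by
      field_simp
    linarith
  have : NeZero μ := ⟨hμ0⟩
  refine ⟨⟨(μ Set.univ)⁻¹ • μ, inferInstance⟩, fun r hr => ?_⟩
  have h1 := hB r hr
  rw [hΛ] at h1
  simp only [ProbabilityMeasure.coe_mk, integral_smul_measure, ENNReal.toReal_inv, smul_eq_mul]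
  rw [← measureReal_def, ← div_eq_inv_mul, le_div_iff₀ hm]
  exact hVs.trans h1

end FunctionalAnalysis

/-! ### Passing between integrals and masses for families of measures -/

section MeasureFamilies

/-- If the masses of all measurable sets, as functions of a parameter, lie in a closed subspace, so
do the integrals. -/
theorem integral_mem_of_measureReal_mem {α X : Type*} [MeasurableSpace X] {μ : α → Measure X}
    {S : Submodule ℝ (α → ℝ)} (hS : IsClosed (S : Set (α → ℝ)))
    (h : ∀ B, MeasurableSet B → (fun a => (μ a).real B) ∈ S) {f : X → ℝ} (hf : Measurable f)
    (hfi : ∀ a, Integrable f (μ a)) : (fun a => ∫ x, f x ∂μ a) ∈ S := by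
  -- The simple approximants do not depend on `a`, so one sequence serves all the measures, and
  -- convergence in the product topology is convergence for each `a`.
  have hlim : Tendsto (fun n a => (SimpleFunc.approxOn f hf Set.univ 0 (Set.mem_univ _) n).integral (μ a))
      atTop (𝓝 fun a => ∫ x, f x ∂μ a) :=
    tendsto_pi_nhds.2 fun a =>
      tendsto_integral_approxOn_of_measurable (hfi a) hf (by simp) (Set.mem_univ _) (integrable_zero _ _ _)
  refine hS.mem_of_tendsto hlim (Eventually.of_forall fun n => ?_)
  set g := SimpleFunc.approxOn f hf Set.univ 0 (Set.mem_univ _) n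
  have : (fun a => g.integral (μ a)) = ∑ y ∈ g.range, y • fun a => (μ a).real (g ⁻¹' {y}) := by
    funext a
    simp [SimpleFunc.integral_eq, mul_comm]
  change (fun a => g.integral (μ a)) ∈ S
  rw [this]
  exact S.sum_mem fun y _ => S.smul_mem _ (h _ (g.measurableSet_fiber y))

/-- If the integrals of all continuous functions on a compact metric space, as functions of a
parameter, lie in a closed subspace, so do the masses of Borel sets. -/
theorem measureReal_mem_of_integral_mem {α X : Type*} [MetricSpace X] [MeasurableSpace X]
    [BorelSpace X] {μ : α → Measure X} [∀ a, IsFiniteMeasure (μ a)]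
    {S : Submodule ℝ (α → ℝ)} (hS : IsClosed (S : Set (α → ℝ)))
    (h : ∀ f : C(X, ℝ), (fun a => ∫ x, f x ∂μ a) ∈ S) {B : Set X} (hB : MeasurableSet B) :
    (fun a => (μ a).real B) ∈ S := by
  have huniv : (fun a => (μ a).real Set.univ) ∈ S := by
    have := h (ContinuousMap.const X 1)
    simpa using this
  refine MeasurableSpace.induction_on_inter (C := fun B _ => (fun a => (μ a).real B) ∈ S)
    (BorelSpace.measurable_eq.trans borel_eq_generateFrom_isClosed) isPiSystem_isClosed
    ?_ ?_ ?_ ?_ B hB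
  · simp only [measureReal_empty]
    exact S.zero_mem
  · intro F hF
    have hF : IsClosed F := hF
    -- The indicator of a closed set is a limit of continuous thickened indicators, again chosen
    -- independently of `a`.
    have hδ : ∀ n : ℕ, 0 < 1 / ((n : ℝ) + 1) := fun n => Nat.one_div_pos_of_nat
    refine hS.mem_of_tendsto (tendsto_pi_nhds.2 fun a =>
      tendsto_integral_thickenedIndicator_of_isClosed (μ a) hF hδ
        tendsto_one_div_add_atTop_nhds_zero_nat) (Eventually.of_forall fun n => ?_)
    exact h ⟨fun x => (thickenedIndicator (hδ n) F x : ℝ), by fun_prop⟩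
  · intro B hB hmem
    have : (fun a => (μ a).real Bᶜ) = (fun a => (μ a).real Set.univ) - fun a => (μ a).real B := by
      funext a
      exact measureReal_compl hB
    rw [this]
    exact S.sub_mem huniv hmem
  · intro B hd hB hmem
    refine hS.mem_of_tendsto (b := atTop) (f := fun s : Finset ℕ => ∑ i ∈ s, fun a => (μ a).real (B i))
      (tendsto_pi_nhds.2 fun a => ?_) (Eventually.of_forall fun s => S.sum_mem fun i _ => hmem i)
    have h1 := (ENNReal.summable_toReal
      (f := fun i => μ a (B i)) (by rw [← measure_iUnion hd hB]; exact measure_ne_top _ _)).hasSum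
    have h2 : (μ a).real (⋃ i, B i) = ∑' i, (μ a (B i)).toReal := by
      rw [measureReal_def, measure_iUnion hd hB, ENNReal.tsum_toReal_eq fun i => measure_ne_top _ _]
    rw [h2]
    simpa [HasSum, measureReal_def] using h1

/-- Integrals of a bounded function against measures that are uniformly close on measurable sets
are close. -/
theorem integral_le_integral_add {X : Type*} [MeasurableSpace X] {P Q : Measure X}
    [IsProbabilityMeasure P] [IsProbabilityMeasure Q] {ε : ℝ} (hε : 0 ≤ ε)
    (h : ∀ B, MeasurableSet B → P B ≤ Q B + ENNReal.ofReal ε) {f : X → ℝ} (hf : Measurable f)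
    {C : ℝ} (hC : ∀ x, |f x| ≤ C) : ∫ x, f x ∂P ≤ ∫ x, f x ∂Q + 2 * C * ε := by
  have hC0 : 0 ≤ C := by
    obtain ⟨x⟩ := P.nonempty_of_neZero
    exact (abs_nonneg _).trans (hC x)
  set g : X → ℝ := fun x => f x + C
  have hg0 : ∀ x, 0 ≤ g x := fun x => by have := (abs_le.1 (hC x)).1; simp only [g]; linarith
  have hg1 : ∀ x, g x ≤ 2 * C := fun x => by have := (abs_le.1 (hC x)).2; simp only [g]; linarith
  have hgm : Measurable g := hf.add_const C
  have hfi : ∀ (ν : Measure X) [IsProbabilityMeasure ν], Integrable f ν := fun ν _ =>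
    .of_bound hf.aestronglyMeasurable C (ae_of_all _ hC)
  have hgi : ∀ (ν : Measure X) [IsProbabilityMeasure ν], Integrable g ν := fun ν _ =>
    (hfi ν).add (integrable_const C)
  -- Layer-cake formula: the levels of `g = f + C` fill an interval of length `2 * C`, and each
  -- superlevel set costs at most `ε`. The shift by `C` cancels at the end because both measures
  -- have mass one.
  have hlc : ∀ (ν : Measure X) [IsProbabilityMeasure ν],
      ∫⁻ x, ENNReal.ofReal (g x) ∂ν = ∫⁻ t in Set.Ioc 0 (2 * C), ν {x | t < g x} := by
    intro ν _
    rw [lintegral_eq_lintegral_meas_lt ν (ae_of_all _ hg0) hgm.aemeasurable,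
      ← Set.Ioc_union_Ioi_eq_Ioi (by positivity : (0 : ℝ) ≤ 2 * C),
      lintegral_union measurableSet_Ioi (Set.Ioc_disjoint_Ioi le_rfl)]
    rw [setLIntegral_congr_fun (g := fun _ => 0) measurableSet_Ioi]
    · simp
    · intro t ht
      have : {x | t < g x} = ∅ := by
        ext x
        simpa using (hg1 x).trans (le_of_lt ht)
      simp [this]
  have hle : ∫⁻ x, ENNReal.ofReal (g x) ∂P ≤
      ∫⁻ x, ENNReal.ofReal (g x) ∂Q + ENNReal.ofReal (2 * C * ε) := by
    rw [hlc P, hlc Q]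
    calc _ ≤ ∫⁻ t in Set.Ioc 0 (2 * C), (Q {x | t < g x} + ENNReal.ofReal ε) :=
          lintegral_mono fun t => h _ (measurableSet_lt measurable_const hgm)
      _ = _ := by
        rw [lintegral_add_right _ measurable_const, setLIntegral_const, Real.volume_Ioc, sub_zero,
          ← ENNReal.ofReal_mul hε, mul_comm ε]
  have hgle : ∫ x, g x ∂P ≤ ∫ x, g x ∂Q + 2 * C * ε := by
    have hp : 0 ≤ 2 * C * ε := by positivity
    rw [← ofReal_integral_eq_lintegral_ofReal (hgi P) (ae_of_all _ hg0),
      ← ofReal_integral_eq_lintegral_ofReal (hgi Q) (ae_of_all _ hg0),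
      ← ENNReal.ofReal_add (integral_nonneg hg0) hp] at hle
    exact (ENNReal.ofReal_le_ofReal_iff (add_nonneg (integral_nonneg hg0) hp)).1 hle
  have hgf : ∀ (ν : Measure X) [IsProbabilityMeasure ν], ∫ x, g x ∂ν = ∫ x, f x ∂ν + C := by
    intro ν _
    rw [integral_add (hfi ν) (integrable_const C)]
    simp
  rw [hgf, hgf] at hgle
  linarith

end MeasureFamilies

/-! ### Hermitian forms as a closed subspace of functions -/

section QuadraticForms

variable {H : Type*} [NormedAddCommGroup H] [InnerProductSpace ℂ H]

/-- The polarization of a real-valued function on a complex vector space. -/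
def polarization (q : H → ℝ) (x y : H) : ℂ :=
  (q (x + y) - q (x - y) - Complex.I * q (x + Complex.I • y) + Complex.I * q (x - Complex.I • y)) / 4

theorem polarization_add_fun (p q : H → ℝ) (x y : H) :
    polarization (p + q) x y = polarization p x y + polarization q x y := by
  simp only [polarization, Pi.add_apply, Complex.ofReal_add]
  ring

theorem polarization_smul_fun (r : ℝ) (q : H → ℝ) (x y : H) :
    polarization (r • q) x y = r * polarization q x y := by
  simp only [polarization, Pi.smul_apply, smul_eq_mul, Complex.ofReal_mul]
  ring

theorem continuous_polarization (x y : H) :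
    Continuous fun q : H → ℝ => polarization q x y := by
  unfold polarization
  fun_prop

variable (H) in
/-- The quadratic forms of Hermitian sesquilinear forms on `H`. -/
def hermitianForms : Submodule ℝ (H → ℝ) where
  carrier := {q | (∀ x y z, polarization q x (y + z) = polarization q x y + polarization q x z) ∧
    (∀ (c : ℂ) x y, polarization q x (c • y) = c * polarization q x y) ∧
    (∀ x y, polarization q y x = starRingEnd ℂ (polarization q x y)) ∧
    ∀ x, polarization q x x = q x}
  add_mem' := by
    rintro p q ⟨hp1, hp2, hp3, hp4⟩ ⟨hq1, hq2, hq3, hq4⟩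
    refine ⟨fun x y z => ?_, fun c x y => ?_, fun x y => ?_, fun x => ?_⟩
    · simp only [polarization_add_fun, hp1, hq1]; ring
    · simp only [polarization_add_fun, hp2, hq2]; ring
    · simp only [polarization_add_fun, hp3 x, hq3 x, map_add]
    · simp only [polarization_add_fun, hp4, hq4, Pi.add_apply, Complex.ofReal_add]
  zero_mem' := by
    have : ∀ x y : H, polarization (0 : H → ℝ) x y = 0 := fun x y => by simp [polarization]
    simp [this]
  smul_mem' := by
    rintro r q ⟨hq1, hq2, hq3, hq4⟩
    refine ⟨fun x y z => ?_, fun c x y => ?_, fun x y => ?_, fun x => ?_⟩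
    · simp only [polarization_smul_fun, hq1]; ring
    · simp only [polarization_smul_fun, hq2]; ring
    · simp only [polarization_smul_fun, hq3 x, map_mul, Complex.conj_ofReal]
    · simp only [polarization_smul_fun, hq4, Pi.smul_apply, smul_eq_mul, Complex.ofReal_mul]

/-- Each defining condition is an equation involving finitely many values of `q`, hence is preserved
by pointwise limits. The compactness of POVMs rests on this. -/
theorem isClosed_hermitianForms : IsClosed (hermitianForms H : Set (H → ℝ)) := by
  have h := fun x y : H => continuous_polarization x y
  have hs := Complex.continuous_conj
  refine IsClosed.and ?_ (IsClosed.and ?_ (IsClosed.and ?_ ?_)) <;>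
    simp only [Set.ofPred_forall]
  · exact isClosed_iInter fun x => isClosed_iInter fun y => isClosed_iInter fun z =>
      isClosed_eq (h x (y + z)) ((h x y).add (h x z))
  · exact isClosed_iInter fun c => isClosed_iInter fun x => isClosed_iInter fun y =>
      isClosed_eq (h x (c • y)) (continuous_const.mul (h x y))
  · exact isClosed_iInter fun x => isClosed_iInter fun y =>
      isClosed_eq (h y x) (hs.comp (h x y))
  · exact isClosed_iInter fun x =>
      isClosed_eq (h x x) (Complex.continuous_ofReal.comp (continuous_apply x))

theorem polarization_inner [CompleteSpace H] {T : H →L[ℂ] H} (hT : T.IsPositive) (x y : H) :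
    polarization (fun x => (⟪x, T x⟫_ℂ).re) x y = ⟪x, T y⟫_ℂ := by
  have h : ∀ x, (((⟪x, T x⟫_ℂ).re : ℝ) : ℂ) = ⟪x, T x⟫_ℂ := fun x =>
    hT.isSymmetric.coe_re_inner_self_apply x
  unfold polarization
  simp only [h]
  simp only [map_add, map_sub, inner_add_left, inner_add_right, inner_sub_left, inner_sub_right,
    map_smul, inner_smul_left, inner_smul_right, Complex.conj_I]
  linear_combination ((- ⟪x, T y⟫_ℂ + ⟪y, T x⟫_ℂ) / 2) * Complex.I_sq

theorem inner_mem_hermitianForms [CompleteSpace H] {T : H →L[ℂ] H} (hT : T.IsPositive) :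
    (fun x => (⟪x, T x⟫_ℂ).re) ∈ hermitianForms H := by
  refine ⟨fun x y z => ?_, fun c x y => ?_, fun x y => ?_, fun x => ?_⟩
  · simp only [polarization_inner hT, map_add, inner_add_right]
  · simp only [polarization_inner hT, map_smul, inner_smul_right]
  · simp only [polarization_inner hT]
    rw [← hT.inner_left_eq_inner_right, inner_conj_symm]
  · rw [polarization_inner hT]
    exact (hT.isSymmetric.coe_re_inner_self_apply x).symm

/-- A bounded positive Hermitian form is given by a positive operator. -/
theorem exists_operator_of_mem_hermitianForms [CompleteSpace H] {q : H → ℝ}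
    (hq : q ∈ hermitianForms H) (h0 : ∀ x, 0 ≤ q x) (h1 : ∀ x, q x ≤ ‖x‖ ^ 2) :
    ∃ T : H →L[ℂ] H, 0 ≤ T ∧ ∀ x y, ⟪x, T y⟫_ℂ = polarization q x y := by
  obtain ⟨hadd, hsmul, hsymm, hdiag⟩ := hq
  have hadd' : ∀ x y z, polarization q (x + y) z = polarization q x z + polarization q y z := by
    intro x y z
    rw [hsymm z (x + y), hadd, map_add, ← hsymm, ← hsymm]
  have hsmul' : ∀ (c : ℂ) x z, polarization q (c • x) z = starRingEnd ℂ c * polarization q x z := by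
    intro c x z
    rw [hsymm z (c • x), hsmul, map_mul, ← hsymm]
  let B₀ : H →ₗ⋆[ℂ] H →ₗ[ℂ] ℂ :=
    LinearMap.mk₂'ₛₗ (starRingEnd ℂ) (RingHom.id ℂ) (polarization q) hadd' hsmul' hadd hsmul
  have hb1 : ∀ x y, ‖polarization q x y‖ ≤ ‖x‖ ^ 2 + ‖y‖ ^ 2 := by
    intro x y
    have hI : ‖Complex.I • y‖ = ‖y‖ := by simp [norm_smul]
    have p1 := parallelogram_law_with_norm ℂ x y
    have p2 := parallelogram_law_with_norm ℂ x (Complex.I • y)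
    rw [hI] at p2
    have hn : ∀ z : H, ‖(q z : ℂ)‖ ≤ ‖z‖ ^ 2 := fun z => by
      rw [Complex.norm_real, Real.norm_of_nonneg (h0 z)]
      exact h1 z
    have hn' : ∀ z : H, ‖Complex.I * (q z : ℂ)‖ ≤ ‖z‖ ^ 2 := fun z => by
      rw [norm_mul, Complex.norm_I, one_mul]
      exact hn z
    unfold polarization
    rw [norm_div, Complex.norm_ofNat, div_le_iff₀ (by norm_num)]
    refine (norm_add_le _ _).trans ?_
    refine (add_le_add_left (norm_sub_le _ _) _).trans ?_
    refine (add_le_add_left (add_le_add_left (norm_sub_le _ _) _) _).trans ?_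
    linarith [hn (x + y), hn (x - y), hn' (x + Complex.I • y), hn' (x - Complex.I • y)]
  -- The bound `hb1` is not homogeneous in each variable; applied to unit vectors it gives `1 + 1 =
  -- 2`, and sesquilinearity scales back.
  have hb : ∀ x y, ‖B₀ x y‖ ≤ 2 * ‖x‖ * ‖y‖ := by
    intro x y
    change ‖polarization q x y‖ ≤ _
    rcases eq_or_ne x 0 with rfl | hx
    · have := hsmul' 0 0 y
      simp only [zero_smul, map_zero, zero_mul] at this
      simp [this]
    rcases eq_or_ne y 0 with rfl | hy
    · have := hsmul 0 x 0
      simp only [zero_smul, zero_mul] at this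
      simp [this]
    have hx' : ‖x‖ ≠ 0 := norm_ne_zero_iff.2 hx
    have hy' : ‖y‖ ≠ 0 := norm_ne_zero_iff.2 hy
    have h := hb1 (((‖x‖⁻¹ : ℝ) : ℂ) • x) (((‖y‖⁻¹ : ℝ) : ℂ) • y)
    rw [hsmul, hsmul', norm_mul, norm_mul, norm_smul, norm_smul] at h
    simp only [Complex.conj_ofReal, Complex.norm_real, norm_inv, norm_norm] at h
    rw [inv_mul_cancel₀ hx', inv_mul_cancel₀ hy'] at h
    have h2 : ‖polarization q x y‖ =
        ‖x‖ * ‖y‖ * (‖y‖⁻¹ * (‖x‖⁻¹ * ‖polarization q x y‖)) := by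
      field_simp
    rw [h2]
    nlinarith [mul_nonneg (norm_nonneg x) (norm_nonneg y)]
  let B := B₀.mkContinuous₂ 2 hb
  have hB : ∀ x y, ⟪InnerProductSpace.continuousLinearMapOfBilin B x, y⟫_ℂ = polarization q x y :=
    fun x y => InnerProductSpace.continuousLinearMapOfBilin_apply B x y
  refine ⟨InnerProductSpace.continuousLinearMapOfBilin B, ?_, fun x y => ?_⟩
  · rw [ContinuousLinearMap.nonneg_iff_isPositive, ContinuousLinearMap.isPositive_iff_complex]
    intro x
    rw [hB, hdiag]
    exact ⟨rfl, h0 x⟩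
  · rw [← inner_conj_symm, hB, ← hsymm]

end QuadraticForms

/-! ### Traces of positive operators -/

section Operators

theorem re_inner_mono {H : Type*} [NormedAddCommGroup H] [InnerProductSpace ℂ H]
    {S T : H →L[ℂ] H} (h : S ≤ T) (x : H) :
    (⟪x, S x⟫_ℂ).re ≤ (⟪x, T x⟫_ℂ).re := by
  have := ((ContinuousLinearMap.le_def _ _).1 h).re_inner_nonneg_right x
  simp only [sub_apply, inner_sub_right, map_sub] at this
  exact sub_nonneg.1 this

variable {H : Type*} [NormedAddCommGroup H] [InnerProductSpace ℂ H] [CompleteSpace H]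

theorem re_inner_eq_norm_sqrt_sq {T : H →L[ℂ] H} (hT : 0 ≤ T) (x : H) :
    (⟪x, T x⟫_ℂ).re = ‖CFC.sqrt T x‖ ^ 2 := by
  have hs : (CFC.sqrt T).IsPositive :=
    (ContinuousLinearMap.nonneg_iff_isPositive _).1 (CFC.sqrt_nonneg _)
  have h : ⟪x, T x⟫_ℂ = ⟪CFC.sqrt T x, CFC.sqrt T x⟫_ℂ := by
    rw [hs.inner_left_eq_inner_right]
    conv_lhs => rw [← CFC.sqrt_mul_sqrt_self T hT]
    rfl
  rw [h, inner_self_eq_norm_sq_to_K]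
  norm_cast

theorem ofReal_norm_sq_eq_tsum (x : H) :
    ENNReal.ofReal (‖x‖ ^ 2) = ∑' i, ENNReal.ofReal (‖⟪traceBasis H i, x⟫_ℂ‖ ^ 2) := by
  rw [← (hasSum_normSq x).tsum_eq]
  exact ENNReal.ofReal_tsum_of_nonneg (fun i => by positivity) (hasSum_normSq x).summable

/-- Cyclicity of the trace for positive operators: `Tr √T A √T = Tr √A T √A`. -/
theorem tsum_inner_sqrt_comm {S T : H →L[ℂ] H} (hS : 0 ≤ S) (hT : 0 ≤ T) :
    ∑' j, ENNReal.ofReal (⟪CFC.sqrt T (traceBasis H j), S (CFC.sqrt T (traceBasis H j))⟫_ℂ).re =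
      ∑' i, ENNReal.ofReal
        (⟪CFC.sqrt S (traceBasis H i), T (CFC.sqrt S (traceBasis H i))⟫_ℂ).re := by
  have hs : ∀ R : H →L[ℂ] H, (CFC.sqrt R).IsPositive := fun R =>
    (ContinuousLinearMap.nonneg_iff_isPositive _).1 (CFC.sqrt_nonneg _)
  simp only [re_inner_eq_norm_sqrt_sq hS, re_inner_eq_norm_sqrt_sq hT]
  -- By Parseval both sides are double series of `|⟨eᵢ, √S √T eⱼ⟩|²`, up to conjugation; their terms
  -- are nonnegative, so the order of summation is free.
  simp only [ofReal_norm_sq_eq_tsum (CFC.sqrt S _), ofReal_norm_sq_eq_tsum (CFC.sqrt T _)]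
  rw [ENNReal.tsum_comm]
  refine tsum_congr fun i => tsum_congr fun j => ?_
  rw [← (hs S).inner_left_eq_inner_right, ← (hs T).inner_left_eq_inner_right, norm_inner_symm]

theorem traceNorm_of_nonneg {T : H →L[ℂ] H} (hT : 0 ≤ T) :
    traceNorm T = ∑' i, ENNReal.ofReal (⟪traceBasis H i, T (traceBasis H i)⟫_ℂ).re := by
  rw [traceNorm, CFC.abs_of_nonneg T hT]

end Operators

/-! ### POVMs as families of scalar measures -/

section VectorMeasures

variable {H : Type*} [NormedAddCommGroup H] [InnerProductSpace ℂ H] [CompleteSpace H]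
variable {U : Type*} [MeasurableSpace U]

/-- The measure `B ↦ ⟨x, M(B) x⟩`. -/
def POVM.vectorMeasure (M : POVM U H) (x : H) : Measure U :=
  Measure.ofMeasurable (fun B _ => ENNReal.ofReal (⟪x, M.effect B x⟫_ℂ).re)
    (by simp [M.effect_empty])
    (fun _ hB hd => M.ofReal_inner_iUnion hB hd x)

theorem POVM.vectorMeasure_apply (M : POVM U H) (x : H) {B : Set U} (hB : MeasurableSet B) :
    M.vectorMeasure x B = ENNReal.ofReal (⟪x, M.effect B x⟫_ℂ).re :=
  Measure.ofMeasurable_apply B hB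

theorem POVM.effect_isPositive (M : POVM U H) {B : Set U} (hB : MeasurableSet B) :
    (M.effect B).IsPositive :=
  (ContinuousLinearMap.nonneg_iff_isPositive _).1 (M.nonneg B hB)

theorem POVM.vectorMeasure_univ (M : POVM U H) (x : H) :
    M.vectorMeasure x Set.univ = ENNReal.ofReal (‖x‖ ^ 2) := by
  rw [M.vectorMeasure_apply x MeasurableSet.univ, M.effect_univ]
  change ENNReal.ofReal (⟪x, x⟫_ℂ).re = _
  rw [inner_self_eq_norm_sq_to_K]
  norm_cast

instance (M : POVM U H) (x : H) : IsFiniteMeasure (M.vectorMeasure x) :=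
  ⟨by rw [M.vectorMeasure_univ]; exact ENNReal.ofReal_lt_top⟩

theorem POVM.vectorMeasure_real (M : POVM U H) (x : H) {B : Set U} (hB : MeasurableSet B) :
    (M.vectorMeasure x).real B = (⟪x, M.effect B x⟫_ℂ).re := by
  rw [measureReal_def, M.vectorMeasure_apply x hB,
    ENNReal.toReal_ofReal]
  exact (M.effect_isPositive hB).re_inner_nonneg_right x

theorem POVM.re_inner_effect_le (M : POVM U H) (x : H) {B : Set U} (hB : MeasurableSet B) :
    (⟪x, M.effect B x⟫_ℂ).re ≤ ‖x‖ ^ 2 := by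
  have h := measure_mono (μ := M.vectorMeasure x) (Set.subset_univ B)
  rwa [M.vectorMeasure_apply x hB, M.vectorMeasure_univ,
    ENNReal.ofReal_le_ofReal_iff (by positivity)] at h

theorem POVM.vectorMeasure_real_mem (M : POVM U H) {B : Set U} (hB : MeasurableSet B) :
    (fun x => (M.vectorMeasure x).real B) ∈ hermitianForms H := by
  simp only [M.vectorMeasure_real _ hB]
  exact inner_mem_hermitianForms (M.effect_isPositive hB)

/-- The outcome distribution is `∑ⱼ ⟨√ρ eⱼ, M(·) √ρ eⱼ⟩`. -/
theorem POVM.outcome_eq_sum (M : POVM U H) (ρ : DensityOperator H) :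
    M.outcome ρ = Measure.sum fun j => M.vectorMeasure (CFC.sqrt ρ.op (traceBasis H j)) := by
  ext B hB
  rw [M.outcome_apply ρ hB, Measure.sum_apply _ hB, ρ.ofReal_trace_mul (M.nonneg B hB)]
  exact tsum_congr fun j => (M.vectorMeasure_apply _ hB).symm

instance (M : POVM U H) (ρ : DensityOperator H) : IsProbabilityMeasure (M.outcome ρ) :=
  ⟨by rw [M.outcome_apply ρ MeasurableSet.univ, M.effect_univ, mul_one, ρ.trace_eq_one]; simp⟩

theorem POVM.integral_outcome (M : POVM U H) (ρ : DensityOperator H) {f : U → ℝ}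
    (hf : Integrable f (M.outcome ρ)) :
    ∫ u, f u ∂M.outcome ρ =
      ∑' j, ∫ u, f u ∂M.vectorMeasure (CFC.sqrt ρ.op (traceBasis H j)) := by
  have := M.outcome_eq_sum ρ
  rw [this] at hf ⊢
  exact integral_sum_measure hf

theorem POVM.norm_integral_vectorMeasure_le [TopologicalSpace U] [CompactSpace U] (M : POVM U H) (x : H) (f : C(U, ℝ)) :
    ‖∫ u, f u ∂M.vectorMeasure x‖ ≤ ‖f‖ * ‖x‖ ^ 2 := by
  have := norm_integral_le_of_norm_le_const (μ := M.vectorMeasure x)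
    (ae_of_all _ f.norm_coe_le_norm)
  rwa [measureReal_def, M.vectorMeasure_univ, ENNReal.toReal_ofReal (by positivity)] at this

/-- A family of measures whose masses are Hermitian forms comes from a POVM. -/
theorem POVM.exists_of_vectorMeasure {μ : H → Measure U}
    (huniv : ∀ x, μ x Set.univ = ENNReal.ofReal (‖x‖ ^ 2))
    (hform : ∀ B, MeasurableSet B → (fun x => (μ x).real B) ∈ hermitianForms H) :
    ∃ M : POVM U H, ∀ x, M.vectorMeasure x = μ x := by
  classical
  have hfin : ∀ x, IsFiniteMeasure (μ x) := fun x => ⟨by rw [huniv]; exact ENNReal.ofReal_lt_top⟩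
  have hreal_univ : ∀ x, (μ x).real Set.univ = ‖x‖ ^ 2 := fun x => by
    rw [measureReal_def, huniv, ENNReal.toReal_ofReal (by positivity)]
  have hex : ∀ B, MeasurableSet B → ∃ T : H →L[ℂ] H, 0 ≤ T ∧
      ∀ x y, ⟪x, T y⟫_ℂ = polarization (fun x => (μ x).real B) x y := fun B hB =>
    exists_operator_of_mem_hermitianForms (hform B hB) (fun x => measureReal_nonneg)
      fun x => (measureReal_mono (Set.subset_univ B)).trans_eq (hreal_univ x)
  choose! E hE0 hE using hex
  have hdiag : ∀ B, MeasurableSet B → ∀ x, ⟪x, E B x⟫_ℂ = (μ x).real B := fun B hB x => by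
    rw [hE B hB]
    exact (hform B hB).2.2.2 x
  let M : POVM U H :=
    { effect := fun B => if MeasurableSet B then E B else 0
      not_measurable := fun B hB => if_neg hB
      nonneg := fun B hB => by rw [if_pos hB]; exact hE0 B hB
      hasSum_iUnion := by
        intro B hB hd x y
        simp only [if_pos (hB _), if_pos (MeasurableSet.iUnion hB), hE _ (hB _),
          hE _ (MeasurableSet.iUnion hB)]
        have h : ∀ z, HasSum (fun j => ((μ z).real (B j) : ℂ)) ((μ z).real (⋃ j, B j) : ℂ) := by
          intro z
          have h1 := (ENNReal.summable_toReal (f := fun i => μ z (B i))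
            (by rw [← measure_iUnion hd hB]; exact measure_ne_top _ _)).hasSum
          rw [← ENNReal.tsum_toReal_eq fun i => measure_ne_top _ _, ← measure_iUnion hd hB] at h1
          exact_mod_cast h1
        -- Polarization is a finite combination of diagonal values, so countable additivity of the
        -- measures `μ z` gives weak countable additivity.
        unfold polarization
        exact ((((h _).sub (h _)).sub ((h _).mul_left _)).add ((h _).mul_left _)).div_const 4
      effect_univ := by
        rw [if_pos MeasurableSet.univ]
        ext y
        refine ext_inner_left ℂ fun x => ?_
        rw [hE _ MeasurableSet.univ]
        have h1 := polarization_inner (H := H) (ContinuousLinearMap.isPositive_one) x y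
        rw [← h1]
        congr 1
        funext z
        rw [hreal_univ]
        change _ = (⟪z, z⟫_ℂ).re
        rw [inner_self_eq_norm_sq_to_K]
        norm_cast }
  refine ⟨M, fun x => ?_⟩
  ext B hB
  rw [M.vectorMeasure_apply x hB]
  change ENNReal.ofReal (⟪x, (if MeasurableSet B then E B else 0) x⟫_ℂ).re = _
  rw [if_pos hB, hdiag B hB, Complex.ofReal_re, ofReal_measureReal]

/-- POVMs can be randomized. -/
theorem POVM.exists_convexCombination (M₁ M₂ : POVM U H) {a b : ℝ} (ha : 0 ≤ a) (hb : 0 ≤ b)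
    (hab : a + b = 1) : ∃ M : POVM U H, ∀ ρ : DensityOperator H,
      M.outcome ρ = ENNReal.ofReal a • M₁.outcome ρ + ENNReal.ofReal b • M₂.outcome ρ := by
  obtain ⟨M, hM⟩ := POVM.exists_of_vectorMeasure
    (μ := fun x : H =>
      ENNReal.ofReal a • M₁.vectorMeasure x + ENNReal.ofReal b • M₂.vectorMeasure x)
    (fun x => by
      simp only [Measure.add_apply, Measure.smul_apply, POVM.vectorMeasure_univ, smul_eq_mul]
      rw [← add_mul, ← ENNReal.ofReal_add ha hb, hab, ENNReal.ofReal_one, one_mul])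
    (fun B hB => by
      have : (fun x : H => (ENNReal.ofReal a • M₁.vectorMeasure x +
          ENNReal.ofReal b • M₂.vectorMeasure x).real B) =
          a • (fun x => (M₁.vectorMeasure x).real B) + b • fun x => (M₂.vectorMeasure x).real B := by
        funext x
        simp [measureReal_def, ENNReal.toReal_add, ENNReal.mul_ne_top, ha, hb]
      rw [this]
      exact Submodule.add_mem _ (Submodule.smul_mem _ _ (M₁.vectorMeasure_real_mem hB))
        (Submodule.smul_mem _ _ (M₂.vectorMeasure_real_mem hB)))
  refine ⟨M, fun ρ => ?_⟩
  ext B hB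
  simp only [POVM.outcome_eq_sum, Measure.add_apply, Measure.smul_apply, Measure.sum_apply _ hB, hM,
    smul_eq_mul, ENNReal.tsum_add, ENNReal.tsum_mul_left]

/-- The outcome probabilities are monotone in the state, up to the trace of the difference. -/
theorem POVM.outcome_le_add_traceNorm (M : POVM U H) {ρ σ : DensityOperator H} {X : H →L[ℂ] H}
    (hX : 0 ≤ X) (h : ρ.op - σ.op ≤ X) {B : Set U} (hB : MeasurableSet B) :
    M.outcome ρ B ≤ M.outcome σ B + traceNorm X := by
  set A := M.effect B
  have hA : 0 ≤ A := M.nonneg B hB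
  -- By cyclicity the sum is `Tr √X A √X`, which is at most `Tr X` because `A ≤ 1`.
  have hXA : ∑' i, ENNReal.ofReal
      (⟪CFC.sqrt A (traceBasis H i), X (CFC.sqrt A (traceBasis H i))⟫_ℂ).re ≤ traceNorm X := by
    rw [← tsum_inner_sqrt_comm hA hX, traceNorm_of_nonneg hX]
    refine ENNReal.tsum_le_tsum fun j => ENNReal.ofReal_le_ofReal ?_
    rw [re_inner_eq_norm_sqrt_sq hX]
    exact M.re_inner_effect_le _ hB
  refine le_trans ?_ (add_le_add_right hXA _)
  -- In the form `Tr √A ρ √A` the state is evaluated at the vectors `√A eᵢ`, where the operator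
  -- inequality applies term by term.
  rw [M.outcome_apply ρ hB, M.outcome_apply σ hB, ρ.ofReal_trace_mul hA, σ.ofReal_trace_mul hA,
    tsum_inner_sqrt_comm hA ρ.nonneg, tsum_inner_sqrt_comm hA σ.nonneg, ← ENNReal.tsum_add]
  refine ENNReal.tsum_le_tsum fun i => ?_
  refine le_trans (ENNReal.ofReal_le_ofReal ?_) ENNReal.ofReal_add_le
  have := re_inner_mono h (CFC.sqrt A (traceBasis H i))
  simp only [sub_apply, inner_sub_right, Complex.sub_re] at this
  linarith

end VectorMeasures

/-! ### Weak limits of POVMs -/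

section Compactness

variable {H : Type*} [NormedAddCommGroup H] [InnerProductSpace ℂ H] [CompleteSpace H]
variable {U : Type*} [MetricSpace U] [CompactSpace U] [MeasurableSpace U] [BorelSpace U]

theorem integrable_of_continuous {μ : Measure U} [IsFiniteMeasure μ] (f : C(U, ℝ)) :
    Integrable f μ :=
  .of_bound f.continuous.measurable.aestronglyMeasurable ‖f‖ (ae_of_all _ f.norm_coe_le_norm)

/-- Weak compactness of the set of POVMs on a compact metric space. -/
theorem POVM.exists_tendsto_vectorMeasure {ι : Type*} (l : Ultrafilter ι) (M : ι → POVM U H) :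
    ∃ M' : POVM U H, ∀ (x : H) (f : C(U, ℝ)),
      Tendsto (fun i => ∫ u, f u ∂(M i).vectorMeasure x) l (𝓝 (∫ u, f u ∂M'.vectorMeasure x)) := by
  -- Bounded real families converge along an ultrafilter, simultaneously for all `x` and `f`; no
  -- separability of `H` is needed to extract subsequences.
  have hlim : ∀ (x : H) (f : C(U, ℝ)), ∃ c : ℝ,
      Tendsto (fun i => ∫ u, f u ∂(M i).vectorMeasure x) l (𝓝 c) := by
    intro x f
    obtain ⟨c, -, hc⟩ := (isCompact_closedBall (0 : ℝ) (‖f‖ * ‖x‖ ^ 2)).ultrafilter_le_nhds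
      (l.map fun i => ∫ u, f u ∂(M i).vectorMeasure x) (by
        refine le_principal_iff.2 (Ultrafilter.mem_map.2 (Filter.univ_mem' fun i => ?_))
        rw [Set.mem_preimage, mem_closedBall_zero_iff]
        exact (M i).norm_integral_vectorMeasure_le x f)
    exact ⟨c, hc⟩
  choose Λ hΛ using hlim
  let L : H → C(U, ℝ) →ₗ[ℝ] ℝ := fun x =>
    { toFun := Λ x
      map_add' := fun f g => tendsto_nhds_unique (hΛ x (f + g)) <|
        ((hΛ x f).add (hΛ x g)).congr fun i =>
          (integral_add (integrable_of_continuous f) (integrable_of_continuous g)).symm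
      map_smul' := fun c f => tendsto_nhds_unique (hΛ x (c • f)) <|
        ((hΛ x f).const_mul c).congr fun i => (integral_const_mul c _).symm }
  have hL : ∀ x f, 0 ≤ f → 0 ≤ L x f := fun x f hf =>
    ge_of_tendsto' (hΛ x f) fun i => integral_nonneg fun u => hf u
  choose μ hμ hμL using fun x => exists_measure_of_positive (L x) (hL x)
  have hint : ∀ x (f : C(U, ℝ)), ∫ u, f u ∂μ x = Λ x f := hμL
  obtain ⟨M', hM'⟩ := POVM.exists_of_vectorMeasure (μ := μ)
    (fun x => by
      have h1 := hΛ x (ContinuousMap.const U 1)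
      rw [← hint] at h1
      simp only [ContinuousMap.const_apply, integral_const, smul_eq_mul, mul_one, measureReal_def,
        POVM.vectorMeasure_univ] at h1
      rw [← ENNReal.ofReal_toReal (measure_ne_top (μ x) Set.univ),
        ← tendsto_nhds_unique tendsto_const_nhds h1, ENNReal.toReal_ofReal (by positivity)])
    (fun B hB => by
      -- Weak convergence controls only continuous integrands. Masses of each `M i` are Hermitian
      -- forms, hence so are its integrals, hence their limits, and finally the masses of the limit
      -- measures.
      refine measureReal_mem_of_integral_mem isClosed_hermitianForms (fun f => ?_) hB
      refine isClosed_hermitianForms.mem_of_tendsto (b := (l : Filter ι))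
        (f := fun i x => ∫ u, f u ∂(M i).vectorMeasure x)
        (tendsto_pi_nhds.2 fun x => by rw [hint]; exact hΛ x f) (Eventually.of_forall fun i => ?_)
      exact integral_mem_of_measureReal_mem isClosed_hermitianForms
        (fun B hB => (M i).vectorMeasure_real_mem hB) f.continuous.measurable
        fun x => integrable_of_continuous f)
  refine ⟨M', fun x f => ?_⟩
  rw [hM', hint]
  exact hΛ x f

/-- The limit POVM of `POVM.exists_tendsto_vectorMeasure` has the limits of the mean losses. -/
theorem POVM.exists_tendsto_outcome {ι : Type*} (l : Ultrafilter ι) (M : ι → POVM U H) :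
    ∃ M' : POVM U H, ∀ (ρ : DensityOperator H) (f : C(U, ℝ)),
      Tendsto (fun i => ∫ u, f u ∂(M i).outcome ρ) l (𝓝 (∫ u, f u ∂M'.outcome ρ)) := by
  obtain ⟨M', hM'⟩ := POVM.exists_tendsto_vectorMeasure l M
  refine ⟨M', fun ρ f => ?_⟩
  simp only [POVM.integral_outcome _ ρ (integrable_of_continuous f)]
  -- The dominating series `‖f‖ * ‖√ρ eⱼ‖²` is summable because `ρ` is trace class.
  exact tendsto_tsum_of_dominated_convergence (ρ.summable_sq.mul_left ‖f‖) (fun j => hM' _ f)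
    (Eventually.of_forall fun i j => (M i).norm_integral_vectorMeasure_le _ f)

end Compactness

/-! ### Risk functions, minimax POVMs and least favorable priors -/

section Risk

theorem exists_abs_loss_le {Θ U : Type*} [TopologicalSpace Θ] [CompactSpace Θ]
    [TopologicalSpace U] [CompactSpace U] {w : Θ → U → ℝ} (hw : Continuous fun p : Θ × U => w p.1 p.2) :
    ∃ C, 0 ≤ C ∧ ∀ θ u, |w θ u| ≤ C :=
  ⟨‖(⟨_, hw⟩ : C(Θ × U, ℝ))‖, norm_nonneg _,
    fun θ u => (⟨_, hw⟩ : C(Θ × U, ℝ)).norm_coe_le_norm (θ, u)⟩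

variable {H : Type*} [NormedAddCommGroup H] [InnerProductSpace ℂ H] [CompleteSpace H]
variable {Θ : Type*} [MetricSpace Θ]
variable {U : Type*} [MetricSpace U] [CompactSpace U] [MeasurableSpace U] [BorelSpace U]

theorem exists_risk_convexCombination (ρ : Θ → DensityOperator H) {w : Θ → U → ℝ}
    (hw : Continuous fun p : Θ × U => w p.1 p.2) (M₁ M₂ : POVM U H) {a b : ℝ} (ha : 0 ≤ a)
    (hb : 0 ≤ b) (hab : a + b = 1) :
    ∃ M : POVM U H, ∀ θ, risk ρ w M θ = a * risk ρ w M₁ θ + b * risk ρ w M₂ θ := by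
  obtain ⟨M, hM⟩ := POVM.exists_convexCombination M₁ M₂ ha hb hab
  refine ⟨M, fun θ => ?_⟩
  have hwθ : Continuous (w θ) := hw.comp (by fun_prop : Continuous fun u => (θ, u))
  have hint : ∀ M : POVM U H, Integrable (w θ) (M.outcome (ρ θ)) := fun M =>
    integrable_of_continuous ⟨w θ, hwθ⟩
  simp only [risk, hM]
  rw [integral_add_measure ((hint M₁).smul_measure ENNReal.ofReal_ne_top)
    ((hint M₂).smul_measure ENNReal.ofReal_ne_top)]
  simp [ha, hb]

/-- A POVM of smallest worst-case risk exists as soon as there is a POVM. -/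
theorem exists_isMinimaxPOVM [Nonempty (POVM U H)] (ρ : Θ → DensityOperator H)
    {w : Θ → U → ℝ} (hw : Continuous fun p : Θ × U => w p.1 p.2) :
    ∃ M : POVM U H, IsMinimaxPOVM ρ w M := by
  let s : POVM U H → EReal := fun M => ⨆ θ, (risk ρ w M θ : EReal)
  obtain ⟨u, -, hu, hmem⟩ := exists_seq_tendsto_sInf (Set.range_nonempty s) (OrderBot.bddBelow _)
  choose M hM using hmem
  obtain ⟨M', hM'⟩ := POVM.exists_tendsto_outcome (hyperfilter ℕ) M
  refine ⟨M', fun N => le_trans (iSup_le fun θ => ?_) (sInf_le ⟨N, rfl⟩ : sInf (Set.range s) ≤ _)⟩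
  have hwθ : Continuous (w θ) := hw.comp (by fun_prop : Continuous fun u => (θ, u))
  have h1 : Tendsto (fun n => (risk ρ w (M n) θ : EReal)) (hyperfilter ℕ) (𝓝 (risk ρ w M' θ)) :=
    (continuous_coe_real_ereal.tendsto _).comp (hM' (ρ θ) ⟨w θ, hwθ⟩)
  -- Only the limit at a fixed `θ` is compared with the limiting supremum, so no uniformity in `θ`
  -- is required.
  refine le_of_tendsto_of_tendsto' h1 (hu.mono_left Nat.hyperfilter_le_atTop) fun n => ?_
  rw [← hM n]
  exact le_iSup (fun θ => (risk ρ w (M n) θ : EReal)) θ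

variable [CompactSpace Θ]

/-- The risk functions of a regular family of states are continuous. -/
theorem continuous_risk {ρ : Θ → DensityOperator H}
    (hρ : IsRegularFamily fun θ => (ρ θ).op) {w : Θ → U → ℝ}
    (hw : Continuous fun p : Θ × U => w p.1 p.2) (M : POVM U H) : Continuous (risk ρ w M) := by
  obtain ⟨C, hC0, hC⟩ := exists_abs_loss_le hw
  have hwθ : ∀ θ, Continuous (w θ) := fun θ => hw.comp (by fun_prop : Continuous fun u => (θ, u))
  have hint : ∀ θ η, Integrable (w θ) (M.outcome (ρ η)) := fun θ η =>
    integrable_of_continuous ⟨w θ, hwθ θ⟩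
  rw [Metric.continuous_iff]
  intro η ε hε
  obtain ⟨δ₁, hδ₁, huc⟩ := Metric.uniformContinuous_iff.1
    (CompactSpace.uniformContinuous_of_continuous hw) (ε / 3) (by positivity)
  -- Makes the cost `2 * C * κ` of changing the state at most `ε / 3`; `C + 1` keeps the denominator
  -- positive when `C = 0`.
  set κ : ℝ := ε / (6 * (C + 1))
  have hκ : 0 < κ := by positivity
  have hκC : 2 * C * κ ≤ ε / 3 := by
    have : (C + 1) * κ = ε / 6 := by simp only [κ]; field_simp
    nlinarith
  obtain ⟨δ₂, hlt, hδ₂⟩ := (((hρ Set.univ isCompact_univ).eventually_lt_const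
    (ENNReal.ofReal_pos.2 hκ)).and self_mem_nhdsWithin).exists
  simp only [regularityModulus, iInf_lt_iff] at hlt
  obtain ⟨X, ⟨-, hX⟩, hXκ⟩ := hlt
  -- The regularity bound with both parameters equal reads `-X ≤ 0 ≤ X`.
  have hX0 : 0 ≤ X := by
    obtain ⟨h1, h2⟩ := hX η trivial η trivial (by simpa using hδ₂)
    simpa using h2
  -- The loss is changed first, with the state `ρ θ` kept, by uniform continuity of `w`; then the
  -- state, with the loss `w θ'` kept, by regularity.
  have key : ∀ θ θ' : Θ, dist θ θ' < min δ₁ δ₂ →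
      risk ρ w M θ ≤ risk ρ w M θ' + 2 * C * κ + ε / 3 := by
    intro θ θ' hd
    have h1 : ∫ u, w θ u ∂M.outcome (ρ θ) ≤ ∫ u, (w θ' u + ε / 3) ∂M.outcome (ρ θ) := by
      refine integral_mono (hint _ _) ((hint _ _).add (integrable_const _)) fun u => ?_
      have h := @huc (θ, u) (θ', u) (by
        rw [Prod.dist_eq, dist_self, max_eq_left dist_nonneg]
        exact hd.trans_le (min_le_left _ _))
      have := (abs_lt.1 (Real.dist_eq _ _ ▸ h)).2
      simp only at this ⊢
      linarith
    rw [integral_add (hint _ _) (integrable_const _)] at h1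
    have h2 := integral_le_integral_add (P := M.outcome (ρ θ)) (Q := M.outcome (ρ θ')) hκ.le
      (fun B hB => (M.outcome_le_add_traceNorm hX0
        (hX θ trivial θ' trivial (hd.trans_le (min_le_right _ _))).2 hB).trans
        (add_le_add_right hXκ.le _)) (hwθ θ').measurable (hC θ')
    simp only [integral_const, probReal_univ, one_smul] at h1
    simp only [risk]
    linarith
  refine ⟨min δ₁ δ₂, lt_min hδ₁ hδ₂, fun θ hd => ?_⟩
  have h1 := key θ η hd
  have h2 := key η θ (by rwa [dist_comm])
  rw [Real.dist_eq, abs_lt]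
  constructor <;> linarith

variable [MeasurableSpace Θ] [BorelSpace Θ]

/-- The average risk is at most the worst-case risk. -/
theorem averageRisk_le_iSup_risk {ρ : Θ → DensityOperator H}
    (hρ : IsRegularFamily fun θ => (ρ θ).op) {w : Θ → U → ℝ}
    (hw : Continuous fun p : Θ × U => w p.1 p.2) (M : POVM U H) (π : ProbabilityMeasure Θ) :
    (averageRisk ρ w M π : EReal) ≤ ⨆ θ, (risk ρ w M θ : EReal) := by
  have : Nonempty Θ := π.nonempty
  obtain ⟨θ, -, hθ⟩ := isCompact_univ.exists_isMaxOn Set.univ_nonempty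
    (continuous_risk hρ hw M).continuousOn
  refine le_trans (EReal.coe_le_coe_iff.2 ?_)
    (le_iSup (fun θ => (risk ρ w M θ : EReal)) θ)
  have h := integral_mono (μ := (π : Measure Θ))
    (integrable_of_continuous ⟨_, continuous_risk hρ hw M⟩) (integrable_const (risk ρ w M θ))
    fun θ' => hθ (Set.mem_univ θ')
  simpa [averageRisk] using h

/-- The minimax theorem: some prior has a Bayes risk that equals the minimax risk. -/
theorem exists_prior_iInf_averageRisk_eq [Nonempty Θ] {ρ : Θ → DensityOperator H}
    (hρ : IsRegularFamily fun θ => (ρ θ).op) {w : Θ → U → ℝ}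
    (hw : Continuous fun p : Θ × U => w p.1 p.2) {M₀ : POVM U H} (hM₀ : IsMinimaxPOVM ρ w M₀) :
    ∃ π : ProbabilityMeasure Θ,
      ⨆ θ, (risk ρ w M₀ θ : EReal) ≤ ⨅ M : POVM U H, (averageRisk ρ w M π : EReal) := by
  have hcont := fun M : POVM U H => continuous_risk hρ hw M
  have hmax : ∀ M : POVM U H, ∃ θ, ∀ θ', risk ρ w M θ' ≤ risk ρ w M θ := by
    intro M
    obtain ⟨θ, -, hθ⟩ := isCompact_univ.exists_isMaxOn Set.univ_nonempty (hcont M).continuousOn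
    exact ⟨θ, fun θ' => hθ (Set.mem_univ θ')⟩
  obtain ⟨θ₀, hθ₀⟩ := hmax M₀
  obtain ⟨π, hπ⟩ := exists_probabilityMeasure_le_integral (X := Θ)
    (R := Set.range fun M : POVM U H => (⟨_, hcont M⟩ : C(Θ, ℝ))) (V := risk ρ w M₀ θ₀)
    (by
      rintro - ⟨M₁, rfl⟩ - ⟨M₂, rfl⟩ a b ha hb hab
      obtain ⟨M, hM⟩ := exists_risk_convexCombination ρ hw M₁ M₂ ha hb hab
      exact ⟨M, ContinuousMap.ext hM⟩)
    (by
      rintro - ⟨M, rfl⟩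
      obtain ⟨θ, hθ⟩ := hmax M
      refine ⟨θ, EReal.coe_le_coe_iff.1 ?_⟩
      refine (le_iSup (fun θ => (risk ρ w M₀ θ : EReal)) θ₀).trans ((hM₀ M).trans ?_)
      exact iSup_le fun θ' => EReal.coe_le_coe_iff.2 (hθ θ'))
  refine ⟨π, le_iInf fun M => iSup_le fun θ => EReal.coe_le_coe_iff.2 ?_⟩
  exact (hθ₀ θ).trans (hπ _ ⟨M, rfl⟩)

/-- The worst-case risk of `M` lies between its average risk under `π` and the Bayes risk of the
dual prior `π₀`, which a least favorable `π` cannot fall below. -/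
theorem isBayesPOVM_of_isMinimaxPOVM [Nonempty Θ] {ρ : Θ → DensityOperator H}
    (hρ : IsRegularFamily fun θ => (ρ θ).op) {w : Θ → U → ℝ}
    (hw : Continuous fun p : Θ × U => w p.1 p.2) {π : ProbabilityMeasure Θ}
    (hπ : IsLeastFavorablePrior ρ w π) {M : POVM U H} (hM : IsMinimaxPOVM ρ w M) :
    IsBayesPOVM ρ w π M := by
  obtain ⟨π₀, hπ₀⟩ := exists_prior_iInf_averageRisk_eq hρ hw hM
  intro M'
  refine EReal.coe_le_coe_iff.1 ((averageRisk_le_iSup_risk hρ hw M π).trans (hπ₀.trans ?_))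
  refine (le_iSup (fun π' : ProbabilityMeasure Θ =>
    ⨅ M : POVM U H, (averageRisk ρ w M π' : EReal)) π₀).trans ?_
  rw [← hπ]
  exact iInf_le _ M'

theorem exists_isLeastFavorablePrior [Nonempty Θ] {ρ : Θ → DensityOperator H}
    (hρ : IsRegularFamily fun θ => (ρ θ).op) {w : Θ → U → ℝ}
    (hw : Continuous fun p : Θ × U => w p.1 p.2) :
    ∃ π : ProbabilityMeasure Θ, IsLeastFavorablePrior ρ w π := by
  rcases isEmpty_or_nonempty (POVM U H) with h | h
  -- Without any POVM, as can happen for empty `U`, all infima are `⊤` and every prior is least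
  -- favorable.
  · let π : ProbabilityMeasure Θ := ⟨Measure.dirac (Classical.arbitrary Θ), inferInstance⟩
    have : Nonempty (ProbabilityMeasure Θ) := ⟨π⟩
    exact ⟨π, by simp [IsLeastFavorablePrior, iInf_of_empty]⟩
  · obtain ⟨M₀, hM₀⟩ := exists_isMinimaxPOVM ρ hw
    obtain ⟨π, hπ⟩ := exists_prior_iInf_averageRisk_eq hρ hw hM₀
    refine ⟨π, le_antisymm (le_iSup (fun π' : ProbabilityMeasure Θ =>
      ⨅ M : POVM U H, (averageRisk ρ w M π' : EReal)) π) (iSup_le fun π' => ?_)⟩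
    exact (iInf_le _ M₀).trans ((averageRisk_le_iSup_risk hρ hw M₀ π').trans hπ)

end Risk

end QuantumDecision

end

theorem mainTheorem8
    {H : Type*} [NormedAddCommGroup H] [InnerProductSpace ℂ H] [CompleteSpace H]
    {Θ : Type*} [MetricSpace Θ] [CompactSpace Θ] [Nonempty Θ] [MeasurableSpace Θ] [BorelSpace Θ]
    {U : Type*} [MetricSpace U] [CompactSpace U] [MeasurableSpace U] [BorelSpace U]
    (ρ : Θ → QuantumDecision.DensityOperator H)
    (hρ_inj : Function.Injective ρ)
    (hρ_reg : QuantumDecision.IsRegularFamily fun θ => (ρ θ).op)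
    (w : Θ → U → ℝ)
    (hw : Continuous fun p : Θ × U => w p.1 p.2) :
    (∃ π : ProbabilityMeasure Θ, QuantumDecision.IsLeastFavorablePrior ρ w π) ∧
    (∀ π : ProbabilityMeasure Θ, QuantumDecision.IsLeastFavorablePrior ρ w π →
      ∀ M : QuantumDecision.POVM U H,
        QuantumDecision.IsMinimaxPOVM ρ w M → QuantumDecision.IsBayesPOVM ρ w π M) ∧
    (∀ π : ProbabilityMeasure Θ, QuantumDecision.IsLeastFavorablePrior ρ w π →
      ∀ M : QuantumDecision.POVM U H,
        QuantumDecision.IsBayesPOVM ρ w π M →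
        (∀ M' : QuantumDecision.POVM U H, QuantumDecision.IsBayesPOVM ρ w π M' → M' = M) →
        QuantumDecision.IsMinimaxPOVM ρ w M) := by
  refine ⟨QuantumDecision.exists_isLeastFavorablePrior hρ_reg hw, fun π hπ M hM =>
    QuantumDecision.isBayesPOVM_of_isMinimaxPOVM hρ_reg hw hπ hM, fun π hπ M _ huniq => ?_⟩
  -- The given Bayes POVM supplies the nonemptiness that existence of a minimax POVM requires; the
  -- latter is Bayes, so uniqueness identifies the two.
  have : Nonempty (QuantumDecision.POVM U H) := ⟨M⟩
  obtain ⟨M', hM'⟩ := QuantumDecision.exists_isMinimaxPOVM ρ hw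
  rwa [← huniq M' (QuantumDecision.isBayesPOVM_of_isMinimaxPOVM hρ_reg hw hπ hM')]
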